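/- \textbf{Conventions.} A \emph{DG ring} is a unital associative graded ring $A=\bigoplus_{i\in\mathbb{Z}}A^i$ with an additive differential $\mathrm{d}$ of degree $1$ such that $\mathrm{d}\circ\mathrm{d}=0$ and $\mathrm{d}(a\cdot b)=\mathrm{d}(a)\cdot b+(-1)^i\cdot a\cdot \mathrm{d}(b)$ for $a\in A^i$, $b\in A^j$; homomorphisms of DG rings are ring homomorphisms of degree $0$ commuting with the differentials. A homogeneous element $a\in A^i$ is central if $b\cdot a=(-1)^{ij}\cdot a\cdot b$ for all $j$ and all $b\in A^j$; the center $\mathrm{Cent}(A)$ is the set of sums of homogeneous central elements. A \emph{commutative DG ring} is a DG ring $A$ with $A^i=0$ for $i>0$, with $b\cdot a=(-1)^{ij}\cdot a\cdot b$ for all $a\in A^i$, $b\in A^j$, and with $a\cdot a=0$ for all $a\in A^i$ with $i$ odd. For such an $A$, a \emph{central DG $A$-ring} is a DG ring $B$ with a DG ring homomorphism $u_B:A\to B$ such that $u_B(A)\subseteq\mathrm{Cent}(B)$; a homomorphism $f:B\to C$ of central DG $A$-rings is a DG ring homomorphism with $f\circ u_B=u_C$. A \emph{quasi-isomorphism}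 is a homomorphism inducing a bijection on the cohomology $\mathrm{H}=\mathrm{Ker}(\mathrm{d})/\mathrm{Im}(\mathrm{d})$. A \emph{filtered graded set} $(X,F)$ is a graded set $X=\coprod_{i\in\mathbb{Z}}X^i$ with an ascending filtration $\{F_j(X)\}_{j\ge -1}$ by graded subsets, such that $F_{-1}(X)=\varnothing$ and $X=\bigcup_j F_j(X)$. Let $A^\natural$ be the graded ring underlying $A$, and let $A^\natural\langle X\rangle:=A^\natural\otimes_{\mathbb{Z}}\mathbb{Z}\langle X\rangle$ be the noncommutative graded polynomial ring on $X$ over $A^\natural$ (tensor product of graded rings, with the Koszul sign rule), filtered by $F_j(A^\natural\langle X\rangle):=A^\natural\langle F_j(X)\rangle$ for $j\ge 0$ and $F_{-1}(A^\natural\langle X\rangle):=0$. A \emph{noncommutative semi-free DG $A$-ring} is a central DG $A$-ring $\tilde B$ which admits, for some filtered graded set $(X,F)$, an isomorphism of graded $A^\natural$-rings $\tilde B^\natural\cong A^\natural\langle X\rangle$ under which $\mathrm{d}_{\tilde B}(F_j(X))\subseteq F_{j-1}(A^\natural\langle X\rangle)$ for all $j\ge 0$. \textbf{Theorem (Existence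 of Resolutions).} Let $A$ be a nonzero commutative DG ring and let $B$ be a central DG $A$-ring (not necessarily nonpositive). Then there exists a noncommutative semi-free DG $A$-ring resolution of $B$, namely a noncommutative semi-free DG $A$-ring $\tilde B$ together with a homomorphism of DG $A$-rings $\tilde u:\tilde B\to B$ which is surjective and a quasi-isomorphism. -/

import Mathlib

open scoped TensorProduct

universe u v w

noncomputable section

/-- A DG ring: a (unital, associative) `ℤ`-graded ring `⨁ Aⁱ` with a differential of degree `1`,
squaring to zero and satisfying the graded Leibniz rule. -/
structure DGRing where
  carrier : Type u
  [ring : Ring carrier]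
  /-- `gr i` is the homogeneous component of degree `i` (an additive subgroup). -/
  gr : ℤ → Submodule ℤ carrier
  /-- The ring is the internal direct sum of its components, `1 ∈ A⁰` and `Aⁱ · Aʲ ⊆ Aⁱ⁺ʲ`. -/
  [graded : GradedAlgebra gr]
  d : carrier →+ carrier
  d_mem : ∀ {i : ℤ} {a : carrier}, a ∈ gr i → d a ∈ gr (i + 1)
  d_d : ∀ a : carrier, d (d a) = 0
  leibniz : ∀ {i j : ℤ} {a b : carrier}, a ∈ gr i → b ∈ gr j →
    d (a * b) = d a * b + i.negOnePow • (a * d b)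

namespace DGRing

attribute [instance] DGRing.ring DGRing.graded

instance : CoeSort DGRing.{u} (Type u) := ⟨DGRing.carrier⟩

/-- A DG ring homomorphism: a ring homomorphism of degree `0` commuting with differentials. -/
structure Hom (A : DGRing.{u}) (B : DGRing.{v}) where
  toRingHom : A →+* B
  map_gr : ∀ {i : ℤ} {a : A}, a ∈ A.gr i → toRingHom a ∈ B.gr i
  map_d : ∀ a : A, toRingHom (A.d a) = B.d (toRingHom a)

/-- `a` is homogeneous of degree `i`, and central in the graded sense. -/
def IsHomogeneousCentral (A : DGRing.{u}) (i : ℤ) (a : A) : Prop :=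
  a ∈ A.gr i ∧ ∀ (j : ℤ) (b : A), b ∈ A.gr j → b * a = (i * j).negOnePow • (a * b)

/-- The center of a DG ring: the sums of homogeneous central elements. -/
def center (A : DGRing.{u}) : AddSubgroup A :=
  AddSubgroup.closure {a | ∃ i : ℤ, A.IsHomogeneousCentral i a}

/-- Commutative DG ring (CDG ring): nonpositive and strongly commutative. -/
structure IsCommutative (A : DGRing.{u}) : Prop where
  nonpositive : ∀ i : ℤ, 0 < i → A.gr i = ⊥
  comm : ∀ (i j : ℤ) (a b : A), a ∈ A.gr i → b ∈ A.gr j →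
    b * a = (i * j).negOnePow • (a * b)
  odd_sq : ∀ (i : ℤ) (a : A), Odd i → a ∈ A.gr i → a * a = 0

/-- The cocycles `Z(B) = Ker(d)`. -/
def cocycles (B : DGRing.{u}) : AddSubgroup B := B.d.ker

/-- The coboundaries `Im(d)`, as a subgroup of the cocycles. -/
def coboundaries (B : DGRing.{u}) : AddSubgroup B.cocycles := B.d.range.addSubgroupOf B.cocycles

/-- The (total) cohomology `H(B) = Z(B) / Im(d) = ⨁ Hⁱ(B)`. -/
abbrev Cohomology (B : DGRing.{u}) : Type u := B.cocycles ⧸ B.coboundaries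

namespace Hom

variable {B : DGRing.{u}} {C : DGRing.{v}}

/-- The map `Z(B) → Z(C)` induced by a DG ring homomorphism `B → C`. -/
def mapCocycles (f : Hom B C) : B.cocycles →+ C.cocycles :=
  (f.toRingHom.toAddMonoidHom.comp B.cocycles.subtype).codRestrict C.cocycles (fun z => by
    have hz : B.d (z : B) = 0 := z.2
    change C.d (f.toRingHom (z : B)) = 0
    rw [← f.map_d, hz, map_zero])

/-- The map `H(B) → H(C)` induced by a DG ring homomorphism `B → C`. -/
def mapCohomology (f : Hom B C) : B.Cohomology →+ C.Cohomology :=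
  QuotientAddGroup.map B.coboundaries C.coboundaries f.mapCocycles (by
    rintro z ⟨b, hb⟩
    exact ⟨f.toRingHom b, by rw [← f.map_d, hb]; rfl⟩)

/-- A quasi-isomorphism is a DG ring homomorphism inducing a bijection on cohomology. -/
def IsQuasiIso (f : Hom B C) : Prop := Function.Bijective f.mapCohomology

end Hom

end DGRing

/-- A central DG `A`-ring: a DG ring `B` with a structural DG ring homomorphism `A → B` whose
image lies in the center of `B`. -/
structure CentralDGRing (A : DGRing.{u}) where
  toDGRing : DGRing.{v}
  str : DGRing.Hom A toDGRing
  central : ∀ a : A, str.toRingHom a ∈ toDGRing.center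

/-- A homomorphism of central DG `A`-rings: a DG ring homomorphism which is compatible with the
structural homomorphisms. -/
structure CentralDGRing.Hom {A : DGRing.{u}} (B : CentralDGRing.{u, v} A)
    (C : CentralDGRing.{u, w} A) extends DGRing.Hom B.toDGRing C.toDGRing where
  map_str : ∀ a : A, toRingHom (B.str.toRingHom a) = C.str.toRingHom a

/-- A filtered graded set: a set `X = ∐ Xⁱ` (the degree of `x` is `deg x`) with an
ascending exhaustive filtration starting from `F (-1) = ∅`.  The filtration is extended to all
integer indices by `∅`. -/
structure FilteredGradedSet where
  X : Type w
  deg : X → ℤ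
  F : ℤ → Set X
  F_neg : ∀ j : ℤ, j < 0 → F j = ∅
  mono : Monotone F
  exhaustive : ⋃ j : ℤ, F j = Set.univ

/-- The degree of a noncommutative monomial in the variables `X`. -/
def monomialDegree {X : Type w} (deg : X → ℤ) : FreeAddMonoid X →+ ℤ := FreeAddMonoid.lift deg

/-- The grading of the noncommutative polynomial ring `ℤ⟨X⟩`, which is realized as the monoid ring
of the free (noncommutative, additively written) monoid on `X`. -/
abbrev freeRingGr {X : Type w} (deg : X → ℤ) :
    ℤ → Submodule ℤ (AddMonoidAlgebra ℤ (FreeAddMonoid X)) :=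
  AddMonoidAlgebra.gradeBy ℤ (monomialDegree deg)

/-- The noncommutative graded polynomial ring `A⟨X⟩ = A ⊗ ℤ⟨X⟩` over the graded ring underlying
`A`.  The multiplication is that of a tensor product of graded rings (with the Koszul sign), so
the variables commute with `A` in the graded sense. -/
abbrev NCPoly (A : DGRing.{u}) {X : Type w} (deg : X → ℤ) : Type (max u w) :=
  A.gr ᵍ⊗[ℤ] (freeRingGr deg)

namespace NCPoly

variable (A : DGRing.{u}) {X : Type w} (deg : X → ℤ)

/-- The structural ring homomorphism `A → A⟨X⟩`, `a ↦ a ⊗ 1`. -/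
def C : A →+* NCPoly A deg := GradedTensorProduct.includeLeftRingHom A.gr (freeRingGr deg)

/-- The variable `x` as an element `1 ⊗ x` of `A⟨X⟩`. -/
def var (x : X) : NCPoly A deg :=
  GradedTensorProduct.includeRight A.gr (freeRingGr deg)
    (AddMonoidAlgebra.single (FreeAddMonoid.of x) 1)

/-- The component of degree `i` of `A⟨X⟩`: the sums of elements `a ⊗ f` with `a ∈ Aᵖ`,
`f ∈ ℤ⟨X⟩^q` and `p + q = i`. -/
def gr (i : ℤ) : AddSubgroup (NCPoly A deg) :=
  AddSubgroup.closure {t | ∃ (p q : ℤ) (a : A) (f : AddMonoidAlgebra ℤ (FreeAddMonoid X)),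
    p + q = i ∧ a ∈ A.gr p ∧ f ∈ freeRingGr deg q ∧ t = a ᵍ⊗ₜ[ℤ] f}

/-- The subring `A⟨S⟩` of `A⟨X⟩`, generated over `A` by a subset `S` of the variables. -/
def subpoly (S : Set X) : Subring (NCPoly A deg) :=
  Subring.closure (Set.range (C A deg) ∪ var A deg '' S)

/-- The filtration of `A⟨X⟩` induced by the filtration of `X`: `F_j(A⟨X⟩) = A⟨F_j(X)⟩` for
`j ≥ 0`, and zero for `j = -1`. -/
def filtration (X : FilteredGradedSet.{w}) (j : ℤ) : AddSubgroup (NCPoly A X.deg) :=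
  if 0 ≤ j then (subpoly A X.deg (X.F j)).toAddSubgroup else ⊥

end NCPoly

namespace CentralDGRing

variable {A : DGRing.{u}}

/-- `X` is a DG `A`-ring semi-basis of `B`, through the ring isomorphism `φ : B ≃ A⟨X⟩`, which is
an isomorphism of graded rings over `A`. -/
structure IsSemiBasis (B : CentralDGRing.{u, v} A) (X : FilteredGradedSet.{w})
    (φ : B.toDGRing ≃+* NCPoly A X.deg) : Prop where
  map_str : ∀ a : A, φ (B.str.toRingHom a) = NCPoly.C A X.deg a
  map_gr : ∀ (i : ℤ) (b : B.toDGRing), b ∈ B.toDGRing.gr i ↔ φ b ∈ NCPoly.gr A X.deg i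
  d_var : ∀ j : ℤ, 0 ≤ j → ∀ x ∈ X.F j,
    φ (B.toDGRing.d (φ.symm (NCPoly.var A X.deg x))) ∈ NCPoly.filtration A X (j - 1)

/-- `B` is a noncommutative semi-free DG `A`-ring: it admits a semi-basis. -/
def IsSemiFree (B : CentralDGRing.{u, v} A) : Prop :=
  ∃ (X : FilteredGradedSet.{v}) (φ : B.toDGRing ≃+* NCPoly A X.deg), B.IsSemiBasis X φ

/-- `f : B' → B` is a noncommutative semi-free DG `A`-ring resolution of `B`: a surjective
quasi-isomorphism of DG `A`-rings from a noncommutative semi-free DG `A`-ring. -/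
structure Hom.IsSemiFreeResolution {B' : CentralDGRing.{u, v} A} {B : CentralDGRing.{u, w} A}
    (f : B'.Hom B) : Prop where
  semiFree : B'.IsSemiFree
  surjective : Function.Surjective f.toRingHom
  quasiIso : f.toHom.IsQuasiIso

end CentralDGRing

end

/-! Everything reduces to one lifting property of u : A⟨X⟩ → B: for every homogeneous b in B of
degree i and every cocycle r of degree i + 1 with u(r) = d b, there is an element x with d x = r and
u(x) = b. Taking r = 0 lifts cocycles to cocycles; taking r to be a cocycle over d b gives
surjectivity; bounding r in this way gives injectivity on cohomology
(`DGRing.Hom.surjective_and_isQuasiIso`).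

Rather than attaching cells stage by stage, all variables are introduced at once, each labelled by
its own prescription: a triple (i, b, e) of a degree, an image in B and a formal expression e for
its differential, where e may itself mention variables. If the prescription is consistent, d x = e
and u(x) = b; otherwise both are 0. Whether it is consistent depends only on the variables nested
inside e, so d and u are defined by recursion on nesting depth (`step_congr`, `data_eq`). Every
compatible pair (r, b) is then the label of some variable (`exists_var`), and the depth gives the
semi-free filtration.

The algebra underneath is the universal property of A⟨X⟩. Ring homomorphisms out of it yield its
decomposition into degrees, the map u, and also derivations: a graded derivation d with sign
automorphism σ is the same as the multiplicativity of r ↦ [[σ r, d r], [0, r]]. -/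

noncomputable section

/-! ### Monomials in A⟨X⟩ and its universal property. -/

namespace NCPoly

variable (A : DGRing.{u}) {X : Type w} (deg : X → ℤ)

/-- The noncommutative monomial `w` as an element `1 ⊗ w` of `A⟨X⟩`. -/
def mon (w : FreeAddMonoid X) : NCPoly A deg :=
  GradedTensorProduct.includeRight A.gr (freeRingGr deg) (AddMonoidAlgebra.single w 1)

theorem mon_zero : mon A deg 0 = 1 := by
  rw [mon, ← AddMonoidAlgebra.one_def, map_one]

theorem mon_add (w w' : FreeAddMonoid X) :
    mon A deg (w + w') = mon A deg w * mon A deg w' := by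
  rw [mon, mon, mon, ← map_mul, AddMonoidAlgebra.single_mul_single, one_mul]

theorem tmul_eq (a : A) (f : AddMonoidAlgebra ℤ (FreeAddMonoid X)) :
    (a ᵍ⊗ₜ[ℤ] f : NCPoly A deg) =
      C A deg a * GradedTensorProduct.includeRight A.gr (freeRingGr deg) f :=
  (GradedTensorProduct.tmul_one_mul_one_tmul A.gr (freeRingGr deg) a f).symm

theorem C_mul_mon (a : A) (w : FreeAddMonoid X) :
    C A deg a * mon A deg w = a ᵍ⊗ₜ[ℤ] AddMonoidAlgebra.single w (1 : ℤ) :=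
  (tmul_eq A deg a _).symm

theorem single_one_mem (w : FreeAddMonoid X) :
    AddMonoidAlgebra.single w (1 : ℤ) ∈ freeRingGr deg (monomialDegree deg w) :=
  AddMonoidAlgebra.single_mem_gradeBy _ _ _

theorem mon_mul_C {i : ℤ} {a : A} (ha : a ∈ A.gr i) (w : FreeAddMonoid X) :
    mon A deg w * C A deg a =
      (i * monomialDegree deg w).negOnePow • (C A deg a * mon A deg w) := by
  have h := GradedTensorProduct.tmul_coe_mul_coe_tmul A.gr (freeRingGr deg) (1 : A)
    ⟨_, single_one_mem deg w⟩ ⟨a, ha⟩ 1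
  rw [one_mul, mul_one] at h
  rw [C_mul_mon, mul_comm i]
  exact h

end NCPoly

namespace NCPoly

variable (A : DGRing.{u}) {X : Type w} (deg : X → ℤ)

theorem single_eq_zsmul (w : FreeAddMonoid X) (n : ℤ) :
    AddMonoidAlgebra.single w n = n • AddMonoidAlgebra.single w (1 : ℤ) := by
  rw [AddMonoidAlgebra.smul_single, smul_eq_mul, mul_one]

theorem mem_closure_of_mem_freeRingGr {q : ℤ} {f : AddMonoidAlgebra ℤ (FreeAddMonoid X)}
    (hf : f ∈ freeRingGr deg q) :
    f ∈ AddSubgroup.closure {t | ∃ w : FreeAddMonoid X, monomialDegree deg w = q ∧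
      t = AddMonoidAlgebra.single w (1 : ℤ)} := by
  rw [← AddMonoidAlgebra.sum_coeff_single f]
  refine AddSubgroup.sum_mem (ι := FreeAddMonoid X) _ fun w hw => ?_
  rw [single_eq_zsmul]
  refine AddSubgroup.zsmul_mem _ (AddSubgroup.subset_closure ?_) _
  exact ⟨w, hf w hw, rfl⟩

/-- The additive map `f ↦ a ⊗ f`. -/
def mulRight (a : A) : AddMonoidAlgebra ℤ (FreeAddMonoid X) →+ NCPoly A deg :=
  (AddMonoidHom.mulLeft (C A deg a)).comp
    (GradedTensorProduct.includeRight A.gr (freeRingGr deg)).toRingHom.toAddMonoidHom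

theorem mulRight_apply (a : A) (f : AddMonoidAlgebra ℤ (FreeAddMonoid X)) :
    mulRight A deg a f = a ᵍ⊗ₜ[ℤ] f := (tmul_eq A deg a f).symm

/-- Reduces the second tensor factor to single monomials, so that homogeneous elements can be
treated by induction over products a · w. -/
theorem gr_eq_closure (i : ℤ) :
    gr A deg i = AddSubgroup.closure {t | ∃ (p : ℤ) (a : A) (w : FreeAddMonoid X), a ∈ A.gr p ∧
      p + monomialDegree deg w = i ∧ t = C A deg a * mon A deg w} := by
  apply le_antisymm
  · rw [gr, AddSubgroup.closure_le]
    rintro _ ⟨p, q, a, f, hpq, ha, hf, rfl⟩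
    rw [← mulRight_apply]
    refine (AddSubgroup.closure_le ((AddSubgroup.closure _).comap (mulRight A deg a))).2 ?_
      (mem_closure_of_mem_freeRingGr deg hf)
    rintro _ ⟨w, rfl, rfl⟩
    exact AddSubgroup.subset_closure ⟨p, a, w, ha, hpq, rfl⟩
  · rw [AddSubgroup.closure_le]
    rintro _ ⟨p, a, w, ha, hw, rfl⟩
    rw [C_mul_mon]
    exact AddSubgroup.subset_closure ⟨p, _, a, _, hw, ha, single_one_mem deg w, rfl⟩

theorem closure_C_mul_mon :
    AddSubgroup.closure {t | ∃ (a : A) (w : FreeAddMonoid X), t = C A deg a * mon A deg w} = ⊤ := by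
  rw [eq_top_iff]
  rintro t -
  induction t using TensorProduct.induction_on with
  | zero => exact zero_mem _
  | add x y hx hy => exact add_mem hx hy
  | tmul a f =>
    change (a ᵍ⊗ₜ[ℤ] f : NCPoly A deg) ∈ _
    rw [← mulRight_apply]
    induction f using AddMonoidAlgebra.induction_linear with
    | zero => rw [map_zero]; exact zero_mem _
    | add f g hf hg => rw [map_add]; exact add_mem hf hg
    | single w n =>
      rw [single_eq_zsmul, map_zsmul]
      refine AddSubgroup.zsmul_mem _ (AddSubgroup.subset_closure ?_) _
      exact ⟨a, w, rfl⟩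

/-- The ring homomorphism `ℤ⟨X⟩ → S` given by the images of the variables. -/
def liftFree {S : Type*} [Ring S] (g : X → S) : AddMonoidAlgebra ℤ (FreeAddMonoid X) →ₐ[ℤ] S :=
  AddMonoidAlgebra.lift ℤ S (FreeAddMonoid X)
    (AddMonoidHom.toMultiplicativeLeft (FreeAddMonoid.lift (M := Additive S) g))

theorem liftFree_zero {S : Type*} [Ring S] (g : X → S) :
    liftFree g (AddMonoidAlgebra.single 0 1) = 1 := by
  rw [← AddMonoidAlgebra.one_def, map_one]

theorem liftFree_of {S : Type*} [Ring S] (g : X → S) (x : X) :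
    liftFree g (AddMonoidAlgebra.single (FreeAddMonoid.of x) 1) = g x := by
  rw [liftFree, AddMonoidAlgebra.lift_single, one_smul]
  exact FreeAddMonoid.lift_eval_of (M := Additive S) g x

theorem liftFree_add {S : Type*} [Ring S] (g : X → S) (v w : FreeAddMonoid X) :
    liftFree g (AddMonoidAlgebra.single (v + w) 1) =
      liftFree g (AddMonoidAlgebra.single v 1) * liftFree g (AddMonoidAlgebra.single w 1) := by
  rw [← map_mul, AddMonoidAlgebra.single_mul_single, one_mul]

/-- The Koszul relation propagates from letters to words because the sign exponent is additive in
the degree of the word. This is the compatibility that a homomorphism out of the graded tensor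
product requires. -/
theorem mul_liftFree {S : Type*} [Ring S] (f : A →+* S) (g : X → S)
    (h : ∀ (i : ℤ) (a : A) (x : X), a ∈ A.gr i →
      g x * f a = (i * deg x).negOnePow • (f a * g x)) {i : ℤ} {a : A} (ha : a ∈ A.gr i)
    (w : FreeAddMonoid X) :
    f a * liftFree g (AddMonoidAlgebra.single w 1) = (i * monomialDegree deg w).negOnePow •
      (liftFree g (AddMonoidAlgebra.single w 1) * f a) := by
  induction w using FreeAddMonoid.inductionOn with
  | zero => rw [liftFree_zero, map_zero, mul_zero, Int.negOnePow_zero, one_smul, mul_one, one_mul]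
  | of x =>
    rw [liftFree_of, h i a x ha, smul_smul, monomialDegree, FreeAddMonoid.lift_eval_of,
      Int.units_mul_self, one_smul]
  | add v w hv hw =>
    rw [liftFree_add, ← mul_assoc, hv, smul_mul_assoc, mul_assoc, hw, mul_smul_comm, smul_smul,
      ← Int.negOnePow_add, ← mul_add, ← map_add, mul_assoc]

/-- The universal property of `A⟨X⟩`. -/
def lift {S : Type*} [Ring S] (f : A →+* S) (g : X → S)
    (h : ∀ (i : ℤ) (a : A) (x : X), a ∈ A.gr i →
      g x * f a = (i * deg x).negOnePow • (f a * g x)) : NCPoly A deg →+* S :=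
  (GradedTensorProduct.lift A.gr (freeRingGr deg) f.toIntAlgHom (liftFree g) (by
    rintro i j ⟨a, ha⟩ ⟨b, hb⟩
    have := mem_closure_of_mem_freeRingGr deg hb
    change f a * liftFree g b = _ • (liftFree g b * f a)
    clear hb
    induction this using AddSubgroup.closure_induction with
    | mem x hx =>
      obtain ⟨w, rfl, rfl⟩ := hx
      rw [mul_liftFree A deg f g h ha w, mul_comm i]
      rfl
    | zero => rw [map_zero, mul_zero, zero_mul, smul_zero]
    | add x y _ _ hx hy => rw [map_add, mul_add, add_mul, smul_add, hx, hy]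
    | neg x _ hx => rw [map_neg, mul_neg, neg_mul, smul_neg, hx])).toRingHom

theorem lift_C {S : Type*} [Ring S] (f : A →+* S) (g : X → S)
    (h : ∀ (i : ℤ) (a : A) (x : X), a ∈ A.gr i →
      g x * f a = (i * deg x).negOnePow • (f a * g x)) (a : A) :
    lift A deg f g h (C A deg a) = f a := by
  refine (GradedTensorProduct.lift_tmul
    A.gr (freeRingGr deg) f.toIntAlgHom (liftFree g) _ a 1).trans ?_
  rw [map_one, mul_one]
  rfl

theorem lift_var {S : Type*} [Ring S] (f : A →+* S) (g : X → S)
    (h : ∀ (i : ℤ) (a : A) (x : X), a ∈ A.gr i →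
      g x * f a = (i * deg x).negOnePow • (f a * g x)) (x : X) :
    lift A deg f g h (var A deg x) = g x := by
  refine (GradedTensorProduct.lift_tmul
    A.gr (freeRingGr deg) f.toIntAlgHom (liftFree g) _ 1 _).trans ?_
  rw [map_one, one_mul, liftFree_of]

end NCPoly

/-! ### The grading of A⟨X⟩. -/

open DirectSum

/-- A ring with a multiplicative family of subgroups and a multiplicative decomposition is
graded. -/
@[reducible]
def GradedAlgebra.ofRingHom {R : Type*} [Ring R] (G : ℤ → Submodule ℤ R) [SetLike.GradedMonoid G]
    (φ : R →+* ⨁ i, G i) (right_inv : ∀ r, DirectSum.coeAddMonoidHom G (φ r) = r)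
    (left_inv : ∀ i (x : G i), φ (x : R) = DirectSum.of (fun i => G i) i x) : GradedAlgebra G where
  decompose' := φ
  left_inv := right_inv
  right_inv x := by
    induction x using DirectSum.induction_on with
    | zero => simp
    | of i x => simp [left_inv]
    | add x y hx hy => simp [hx, hy]

theorem DirectSum.of_mk_congr {R : Type*} [Ring R] (G : ℤ → Submodule ℤ R) {i j : ℤ} {r s : R}
    (hr : r ∈ G i) (hs : s ∈ G j) (hij : i = j) (hrs : r = s) :
    DirectSum.of (fun i => G i) i ⟨r, hr⟩ = DirectSum.of (fun i => G i) j ⟨s, hs⟩ := by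
  subst hij hrs
  rfl

theorem Submodule.negOnePow_smul_mem {R : Type*} [Ring R] (G : Submodule ℤ R) (n : ℤ) {r : R}
    (hr : r ∈ G) : n.negOnePow • r ∈ G := by
  rw [Units.smul_def]
  exact G.smul_mem _ hr

/-- The ring `A⟨X⟩`, seen as a plain ring. -/
def FreePoly (A : DGRing.{u}) {X : Type w} (deg : X → ℤ) : Type (max u w) := NCPoly A deg

namespace FreePoly

variable (A : DGRing.{u}) {X : Type w} (deg : X → ℤ)

instance : Ring (FreePoly A deg) := inferInstanceAs (Ring (NCPoly A deg))

/-- The inclusion of the coefficients. -/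
def C : A →+* FreePoly A deg := NCPoly.C A deg

/-- The monomials. -/
def mon (w : FreeAddMonoid X) : FreePoly A deg := NCPoly.mon A deg w

/-- The variables. -/
def var (x : X) : FreePoly A deg := NCPoly.var A deg x

/-- The grading of `A⟨X⟩`. -/
def gr (i : ℤ) : Submodule ℤ (FreePoly A deg) := AddSubgroup.toIntSubmodule (M := FreePoly A deg)
  (show AddSubgroup (FreePoly A deg) from NCPoly.gr A deg i)

theorem mon_zero : mon A deg 0 = 1 := NCPoly.mon_zero A deg

theorem mon_of (x : X) : mon A deg (FreeAddMonoid.of x) = var A deg x := rfl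

theorem mon_add (w w' : FreeAddMonoid X) :
    mon A deg (w + w') = mon A deg w * mon A deg w' := NCPoly.mon_add A deg w w'

theorem mon_mul_C {i : ℤ} {a : A} (ha : a ∈ A.gr i) (w : FreeAddMonoid X) :
    mon A deg w * C A deg a =
      (i * monomialDegree deg w).negOnePow • (C A deg a * mon A deg w) := by
  refine (NCPoly.mon_mul_C A deg ha w).trans ?_
  rcases Int.units_eq_one_or (i * monomialDegree deg w).negOnePow with h | h <;> rw [h]
  · rw [one_smul, one_smul]; rfl
  · rw [Units.neg_smul, Units.neg_smul, one_smul, one_smul]; rfl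

variable {A deg} in
theorem gr_induction {i : ℤ} {K : AddSubgroup (FreePoly A deg)}
    (h : ∀ (p : ℤ) (a : A) (w : FreeAddMonoid X), a ∈ A.gr p → p + monomialDegree deg w = i →
      C A deg a * mon A deg w ∈ K) {r : FreePoly A deg} (hr : r ∈ gr A deg i) : r ∈ K := by
  change r ∈ NCPoly.gr A deg i at hr
  rw [NCPoly.gr_eq_closure] at hr
  refine (AddSubgroup.closure_le (G := FreePoly A deg) K).2 ?_ hr
  rintro _ ⟨p, a, w, ha, hw, rfl⟩
  exact h p a w ha hw

theorem C_mul_mon_mem {p : ℤ} {a : A} (ha : a ∈ A.gr p) (w : FreeAddMonoid X) {i : ℤ}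
    (h : p + monomialDegree deg w = i) : C A deg a * mon A deg w ∈ gr A deg i := by
  change _ ∈ NCPoly.gr A deg i
  rw [NCPoly.gr_eq_closure]
  exact AddSubgroup.subset_closure ⟨p, a, w, ha, h, rfl⟩

theorem C_mul_mon_induction {K : AddSubgroup (FreePoly A deg)}
    (h : ∀ (a : A) (w : FreeAddMonoid X), C A deg a * mon A deg w ∈ K) : K = ⊤ := by
  refine top_unique (le_trans (NCPoly.closure_C_mul_mon A deg).ge ?_)
  refine (AddSubgroup.closure_le (G := FreePoly A deg) K).2 ?_
  rintro _ ⟨a, w, rfl⟩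
  exact h a w

theorem homogeneous_induction {K : AddSubgroup (FreePoly A deg)}
    (h : ∀ (p : ℤ) (a : A) (w : FreeAddMonoid X), a ∈ A.gr p → C A deg a * mon A deg w ∈ K) :
    K = ⊤ := by
  refine C_mul_mon_induction A deg fun a w => ?_
  induction a using DirectSum.Decomposition.inductionOn A.gr with
  | zero => rw [map_zero, zero_mul]; exact K.zero_mem
  | homogeneous a => exact h _ _ _ a.2
  | add a b ha hb => rw [map_add, add_mul]; exact K.add_mem ha hb

theorem one_mem_gr : (1 : FreePoly A deg) ∈ gr A deg 0 := by
  have := C_mul_mon_mem A deg (SetLike.GradedOne.one_mem (A := A.gr)) 0 (i := 0) (by simp)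
  rwa [map_one, mon_zero, one_mul] at this

theorem C_mem {p : ℤ} {a : A} (ha : a ∈ A.gr p) : C A deg a ∈ gr A deg p := by
  have := C_mul_mon_mem A deg ha 0 (i := p) (by simp)
  rwa [mon_zero, mul_one] at this

theorem mon_mem (w : FreeAddMonoid X) : mon A deg w ∈ gr A deg (monomialDegree deg w) := by
  have := C_mul_mon_mem A deg (SetLike.GradedOne.one_mem (A := A.gr)) w (zero_add _)
  rwa [map_one, one_mul] at this

theorem var_mem (x : X) : var A deg x ∈ gr A deg (deg x) := mon_mem A deg (FreeAddMonoid.of x)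

theorem mul_mem_gr {i j : ℤ} {r s : FreePoly A deg} (hr : r ∈ gr A deg i) (hs : s ∈ gr A deg j) :
    r * s ∈ gr A deg (i + j) := by
  refine gr_induction (K := (gr A deg (i + j)).toAddSubgroup.comap (AddMonoidHom.mulRight s)) ?_ hr
  intro p a w ha hw
  refine gr_induction
    (K := (gr A deg (i + j)).toAddSubgroup.comap
      (AddMonoidHom.mulLeft (C A deg a * mon A deg w))) ?_ hs
  intro q b v hb hv
  change C A deg a * mon A deg w * (C A deg b * mon A deg v) ∈ gr A deg (i + j)
  rw [mul_assoc, ← mul_assoc (mon A deg w), mon_mul_C A deg hb, smul_mul_assoc, mul_smul_comm,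
    mul_assoc, ← mon_add, ← mul_assoc, ← map_mul]
  refine Submodule.negOnePow_smul_mem _ _
    (C_mul_mon_mem A deg (SetLike.GradedMul.mul_mem ha hb) _ ?_)
  rw [map_add, ← hw, ← hv]
  ring

instance gr.gradedMonoid : SetLike.GradedMonoid (gr A deg) where
  one_mem := one_mem_gr A deg
  mul_mem _ _ _ _ := mul_mem_gr A deg

/-- The inclusion of the homogeneous coefficients. -/
def CGr (i : ℤ) : A.gr i →+ gr A deg i where
  toFun a := ⟨C A deg (a : A), C_mem A deg a.2⟩
  map_zero' := Subtype.ext (map_zero (C A deg))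
  map_add' a b := Subtype.ext (map_add (C A deg) (a : A) (b : A))

/-- The inclusion of the coefficients, as a homomorphism of external direct sums. -/
def CSum : (⨁ i, A.gr i) →+* ⨁ i, gr A deg i :=
  DirectSum.toSemiring (A := fun i => A.gr i)
    (fun i => (DirectSum.of (fun i => gr A deg i) i).comp (CGr A deg i))
    (DirectSum.of_mk_congr (gr A deg) _ _ rfl (map_one (C A deg)))
    (fun {i j} a b => Eq.trans
      (DirectSum.of_mk_congr (gr A deg) _ _ rfl (map_mul (C A deg) (a : A) (b : A)))
      (DirectSum.of_mul_of (A := fun i => gr A deg i) (CGr A deg i a) (CGr A deg j b)).symm)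

/-- The decomposition of the coefficients. -/
def decomposeC : A →+* ⨁ i, gr A deg i :=
  (CSum A deg).comp (DirectSum.decomposeRingEquiv A.gr).toRingHom

theorem decomposeC_of_mem {i : ℤ} {a : A} (ha : a ∈ A.gr i) :
    decomposeC A deg a = DirectSum.of (fun i => gr A deg i) i ⟨C A deg a, C_mem A deg ha⟩ := by
  change CSum A deg (DirectSum.decompose A.gr a) = _
  rw [DirectSum.decompose_of_mem _ ha]
  exact DirectSum.toAddMonoid_of _ _ _

/-- The universal property of `A⟨X⟩`. -/
def lift {S : Type*} [Ring S] (f : A →+* S) (g : X → S)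
    (h : ∀ (i : ℤ) (a : A) (x : X), a ∈ A.gr i →
      g x * f a = (i * deg x).negOnePow • (f a * g x)) : FreePoly A deg →+* S :=
  NCPoly.lift A deg f g h

section

variable {S : Type*} [Ring S] (f : A →+* S) (g : X → S)
    (h : ∀ (i : ℤ) (a : A) (x : X), a ∈ A.gr i →
      g x * f a = (i * deg x).negOnePow • (f a * g x))

theorem lift_C (a : A) : lift A deg f g h (C A deg a) = f a := NCPoly.lift_C A deg f g h a

theorem lift_var (x : X) : lift A deg f g h (var A deg x) = g x := NCPoly.lift_var A deg f g h x

end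

/-- The decomposition of `A⟨X⟩` into homogeneous components. -/
def decomposeHom : FreePoly A deg →+* ⨁ i, gr A deg i :=
  lift A deg (decomposeC A deg)
    (fun x => DirectSum.of (fun i => gr A deg i) (deg x) ⟨var A deg x, var_mem A deg x⟩) (by
      intro i a x ha
      have := mon_mul_C A deg ha (FreeAddMonoid.of x)
      rw [mon_of, show monomialDegree deg (FreeAddMonoid.of x) = deg x from rfl] at this
      rw [decomposeC_of_mem A deg ha, DirectSum.of_mul_of, DirectSum.of_mul_of, Units.smul_def,
        ← map_zsmul]
      exact DirectSum.of_mk_congr _ _ _ (add_comm _ _) this)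

theorem decomposeHom_mon (w : FreeAddMonoid X) :
    decomposeHom A deg (mon A deg w) =
      DirectSum.of (fun i => gr A deg i) _ ⟨mon A deg w, mon_mem A deg w⟩ := by
  induction w using FreeAddMonoid.inductionOn with
  | zero =>
    refine (congrArg _ (mon_zero A deg)).trans ((map_one _).trans ?_)
    exact DirectSum.of_mk_congr _ _ _ (map_zero _).symm (mon_zero A deg).symm
  | of x => exact lift_var A deg _ _ _ x
  | add v w hv hw =>
    refine (congrArg _ (mon_add A deg v w)).trans ((map_mul _ _ _).trans ?_)
    rw [hv, hw, DirectSum.of_mul_of]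
    exact DirectSum.of_mk_congr _ _ _ (map_add _ _ _).symm (mon_add A deg v w).symm

theorem decomposeHom_C_mul_mon {p : ℤ} {a : A} (ha : a ∈ A.gr p) (w : FreeAddMonoid X) {i : ℤ}
    (h : p + monomialDegree deg w = i) : decomposeHom A deg (C A deg a * mon A deg w) =
      DirectSum.of (fun i => gr A deg i) i ⟨_, C_mul_mon_mem A deg ha w h⟩ := by
  rw [map_mul, decomposeHom_mon, decomposeHom, lift_C, decomposeC_of_mem A deg ha,
    DirectSum.of_mul_of]
  exact DirectSum.of_mk_congr _ _ _ h rfl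

/-- Two linear conditions suffice, and both can be checked on products a · w: the decomposition of r
is concentrated in degree i, and its components sum to r. -/
theorem decomposeHom_of_mem {i : ℤ} {r : FreePoly A deg} (hr : r ∈ gr A deg i) :
    decomposeHom A deg r = DirectSum.of (fun i => gr A deg i) i ⟨r, hr⟩ := by
  have h1 : r ∈ (DirectSum.of (fun i => gr A deg i) i).range.comap
      (decomposeHom A deg).toAddMonoidHom := by
    refine gr_induction (fun p a w ha hw => ?_) hr
    exact ⟨_, (decomposeHom_C_mul_mon A deg ha w hw).symm⟩
  have h2 : r ∈ AddMonoidHom.eqLocus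
        ((DirectSum.coeAddMonoidHom (gr A deg)).comp (decomposeHom A deg).toAddMonoidHom)
        (AddMonoidHom.id _) := by
    refine gr_induction (fun p a w ha hw => ?_) hr
    change DirectSum.coeAddMonoidHom (gr A deg) (decomposeHom A deg _) = _
    rw [decomposeHom_C_mul_mon A deg ha w hw, DirectSum.coeAddMonoidHom_of]
    rfl
  obtain ⟨⟨s, hs⟩, h1⟩ := h1
  change DirectSum.coeAddMonoidHom (gr A deg) (decomposeHom A deg r) = r at h2
  change _ = decomposeHom A deg r at h1
  rw [← h1, DirectSum.coeAddMonoidHom_of] at h2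
  rw [← h1]
  exact DirectSum.of_mk_congr _ _ _ rfl h2

variable {A deg} in
/-- `A⟨X⟩` is generated by the coefficients and the variables. -/
theorem closure_C_var : Subring.closure (Set.range (C A deg) ∪ Set.range (var A deg)) = ⊤ := by
  have : (Subring.closure (Set.range (C A deg) ∪ Set.range (var A deg))).toAddSubgroup = ⊤ := by
    refine C_mul_mon_induction A deg fun a w => Subring.mul_mem _ ?_ ?_
    · exact Subring.subset_closure (Or.inl ⟨a, rfl⟩)
    · induction w using FreeAddMonoid.inductionOn with
      | zero => rw [mon_zero]; exact Subring.one_mem _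
      | of x => exact Subring.subset_closure (Or.inr ⟨x, rfl⟩)
      | add v w hv hw => rw [mon_add]; exact Subring.mul_mem _ hv hw
  rw [eq_top_iff]
  intro r _
  exact this.ge trivial

variable {A deg} in
theorem induction {P : FreePoly A deg → Prop} (hC : ∀ a, P (C A deg a)) (hvar : ∀ x, P (var A deg x))
    (add : ∀ r s, P r → P s → P (r + s)) (mul : ∀ r s, P r → P s → P (r * s)) (r : FreePoly A deg) :
    P r := by
  have hr : r ∈ Subring.closure (Set.range (C A deg) ∪ Set.range (var A deg)) :=
    closure_C_var.ge trivial
  induction hr using Subring.closure_induction with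
  | mem x hx =>
    rcases hx with ⟨a, rfl⟩ | ⟨x, rfl⟩
    exacts [hC a, hvar x]
  | zero => rw [← map_zero (C A deg)]; exact hC _
  | one => rw [← map_one (C A deg)]; exact hC _
  | add x y _ _ hx hy => exact add _ _ hx hy
  | mul x y _ _ hx hy => exact mul _ _ hx hy
  | neg x _ hx =>
    rw [← neg_one_mul, ← map_one (C A deg), ← map_neg]
    exact mul _ _ (hC _) hx

/-- Independence of the homogeneous components needs no direct argument: the universal property
supplies `decomposeHom`, and it is inverse to summation. -/
instance gr.gradedAlgebra : GradedAlgebra (gr A deg) :=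
  GradedAlgebra.ofRingHom (gr A deg) (decomposeHom A deg) (by
    have key : (DirectSum.coeAddMonoidHom (gr A deg)).comp (decomposeHom A deg).toAddMonoidHom =
        AddMonoidHom.id _ := by
      refine AddMonoidHom.eq_of_eqOn_top fun r _ => ?_
      refine (homogeneous_induction A deg (K := AddMonoidHom.eqLocus _ _) ?_).ge
        (AddSubgroup.mem_top r)
      intro p a w ha
      change DirectSum.coeAddMonoidHom (gr A deg) (decomposeHom A deg _) = _
      rw [decomposeHom_C_mul_mon A deg ha w rfl, DirectSum.coeAddMonoidHom_of]
      rfl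
    exact DFunLike.congr_fun key) (fun i x => decomposeHom_of_mem A deg x.2)

end FreePoly

/-! ### The sign automorphism, the Leibniz rule on all elements, and graded centrality. -/

section GradedSign

variable {R : Type*} [Ring R] (G : ℤ → Submodule ℤ R) [GradedAlgebra G]

/-- The automorphism of a graded ring which is multiplication by `(-1)ⁱ` in degree `i`. -/
def gradedSign : R →+* R :=
  (DirectSum.toSemiring (A := fun i => G i)
    (fun i => (zmultiplesHom (AddMonoid.End R) (AddMonoidHom.id R) i.negOnePow).comp
      (G i).toAddSubgroup.subtype)
    (by
      change (((0 : ℤ).negOnePow : ℤ) • (AddMonoidHom.id R : AddMonoid.End R)) (1 : R) = 1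
      simp)
    (fun {i j} a b => by
      change (i + j).negOnePow • ((a : R) * (b : R)) =
        (i.negOnePow • (a : R)) * (j.negOnePow • (b : R))
      rw [smul_mul_assoc, mul_smul_comm, smul_smul, Int.negOnePow_add])).comp
    (DirectSum.decomposeRingEquiv G).toRingHom

theorem gradedSign_of_mem {i : ℤ} {a : R} (ha : a ∈ G i) : gradedSign G a = i.negOnePow • a := by
  change DirectSum.toAddMonoid _ (DirectSum.decompose G a) = _
  rw [DirectSum.decompose_of_mem _ ha, DirectSum.toAddMonoid_of, Units.smul_def]
  rfl

theorem eq_of_eq_on_homogeneous {S : Type*} [AddCommMonoid S] {f g : R →+ S}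
    (h : ∀ (i : ℤ) (a : R), a ∈ G i → f a = g a) (a : R) : f a = g a := by
  induction a using DirectSum.Decomposition.inductionOn G with
  | zero => rw [map_zero, map_zero]
  | homogeneous a => exact h _ _ a.2
  | add a b ha hb => rw [map_add, map_add, ha, hb]

theorem map_negOnePow_smul {R S : Type*} [AddCommGroup R] [AddCommGroup S] (f : R →+ S) (n : ℤ)
    (r : R) : f (n.negOnePow • r) = n.negOnePow • f r := by
  rw [Units.smul_def, Units.smul_def, map_zsmul]

end GradedSign

namespace DGRing

theorem d_mul (A : DGRing.{u}) (a b : A) :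
    A.d (a * b) = A.d a * b + gradedSign A.gr a * A.d b := by
  induction a using DirectSum.Decomposition.inductionOn A.gr with
  | zero => simp
  | add a a' ha ha' => rw [add_mul, map_add, map_add, map_add, ha, ha', add_mul, add_mul]; abel
  | homogeneous a =>
    induction b using DirectSum.Decomposition.inductionOn A.gr with
    | zero => simp
    | add b b' hb hb' => rw [mul_add, map_add, map_add, hb, hb', mul_add, mul_add]; abel
    | homogeneous b => rw [A.leibniz a.2 b.2, gradedSign_of_mem _ a.2, smul_mul_assoc]

theorem d_one (A : DGRing.{u}) : A.d 1 = 0 := by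
  have := A.d_mul 1 1
  rwa [mul_one, mul_one, map_one (gradedSign A.gr), one_mul, left_eq_add] at this

theorem coe_decompose_of_central (B : DGRing.{u}) {y : B} (hy : y ∈ B.center) (i : ℤ) :
    B.IsHomogeneousCentral i (DirectSum.decompose B.gr y i) := by
  have hadd : ∀ a b : B, B.IsHomogeneousCentral i a → B.IsHomogeneousCentral i b →
      B.IsHomogeneousCentral i (a + b) := fun a b ha hb => ⟨add_mem ha.1 hb.1, fun j c hc => by
    rw [mul_add, add_mul, smul_add, ha.2 j c hc, hb.2 j c hc]⟩
  have hzero : B.IsHomogeneousCentral i 0 :=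
    ⟨zero_mem _, fun j c hc => by rw [mul_zero, zero_mul, smul_zero]⟩
  induction hy using AddSubgroup.closure_induction with
  | mem y hy =>
    obtain ⟨k, hk⟩ := hy
    by_cases hki : k = i
    · subst hki
      rwa [DirectSum.decompose_of_mem_same _ hk.1]
    · rwa [DirectSum.decompose_of_mem_ne _ hk.1 hki]
  | zero => rwa [DirectSum.decompose_zero]
  | add x y _ _ hx hy => rw [DirectSum.decompose_add]; exact hadd _ _ hx hy
  | neg x _ hx =>
    rw [DirectSum.decompose_neg]
    exact ⟨neg_mem hx.1, fun j c hc => by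
      change c * -_ = _ • (-_ * c)
      rw [mul_neg, neg_mul, smul_neg, hx.2 j c hc]⟩

end DGRing

theorem CentralDGRing.mul_str {A : DGRing.{u}} (B : CentralDGRing.{u, v} A) {i j : ℤ} {a : A}
    (ha : a ∈ A.gr i) {b : B.toDGRing} (hb : b ∈ B.toDGRing.gr j) :
    b * B.str.toRingHom a = (i * j).negOnePow • (B.str.toRingHom a * b) := by
  have := B.toDGRing.coe_decompose_of_central (B.central a) i
  rw [DirectSum.decompose_of_mem_same _ (B.str.map_gr ha)] at this
  exact this.2 j b hb

namespace FreePoly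

variable {A : DGRing.{u}} {X : Type w} (deg : X → ℤ)

theorem gradedSign_C (a : A) :
    gradedSign (gr A deg) (C A deg a) = C A deg (gradedSign A.gr a) := by
  refine eq_of_eq_on_homogeneous A.gr
    (f := ((gradedSign (gr A deg)).comp (C A deg)).toAddMonoidHom)
    (g := ((C A deg).comp (gradedSign A.gr)).toAddMonoidHom) ?_ a
  intro i a ha
  change gradedSign (gr A deg) (C A deg a) = C A deg (gradedSign A.gr a)
  rw [gradedSign_of_mem _ ha, gradedSign_of_mem _ (C_mem A deg ha)]
  exact (map_negOnePow_smul (C A deg).toAddMonoidHom _ _).symm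

/-- Passing a across w costs the Koszul sign by construction of A⟨X⟩; passing it across a
coefficient uses commutativity of A. -/
theorem mul_C (hA : A.IsCommutative) {i j : ℤ} {a : A} (ha : a ∈ A.gr i)
    {r : FreePoly A deg} (hr : r ∈ gr A deg j) :
    r * C A deg a = (i * j).negOnePow • (C A deg a * r) := by
  refine gr_induction (K := AddMonoidHom.eqLocus (AddMonoidHom.mulRight (C A deg a))
    (zmultiplesHom (AddMonoid.End (FreePoly A deg)) (AddMonoidHom.mulLeft (C A deg a))
      (i * j).negOnePow)) ?_ hr
  intro p b w hb hw
  change C A deg b * mon A deg w * C A deg a =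
    (i * j).negOnePow • (C A deg a * (C A deg b * mon A deg w))
  rw [mul_assoc, mon_mul_C A deg ha, mul_smul_comm, ← mul_assoc, ← map_mul, hA.comm i p a b ha hb]
  have := map_negOnePow_smul (C A deg).toAddMonoidHom (i * p) (a * b)
  change C A deg _ = _ • C A deg _ at this
  rw [this, smul_mul_assoc, smul_smul, ← Int.negOnePow_add, map_mul, mul_assoc, ← hw]
  congr 2
  ring

end FreePoly

/-! ### Derivations of A⟨X⟩ extending the differential of A. -/

namespace FreePoly

variable {A : DGRing.{u}} (hA : A.IsCommutative) {X : Type w} {deg : X → ℤ}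

/-- The homomorphism from the coefficients to triangular matrices encoding the differential. -/
def coeffMatrix (A : DGRing.{u}) {X : Type w} (deg : X → ℤ) :
    A →+* Matrix (Fin 2) (Fin 2) (FreePoly A deg) where
  toFun a := !![C A deg (gradedSign A.gr a), C A deg (A.d a); 0, C A deg a]
  map_one' := by
    rw [A.d_one, map_one, map_one, map_zero, Matrix.one_fin_two]
  map_zero' := by
    rw [map_zero, map_zero, map_zero]
    ext i j; fin_cases i <;> fin_cases j <;> simp
  map_add' a b := by
    rw [map_add, map_add, map_add, map_add, map_add]
    ext i j; fin_cases i <;> fin_cases j <;> simp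
  map_mul' a b := by
    rw [A.d_mul, map_mul, map_mul, map_add, map_mul, map_mul, Matrix.mul_fin_two, map_mul]
    simp [add_comm]

/-- The matrix encoding the differential of a variable. -/
def varMatrix (δ : ∀ x, gr A deg (deg x + 1)) (x : X) :
    Matrix (Fin 2) (Fin 2) (FreePoly A deg) :=
  !![gradedSign (gr A deg) (var A deg x), δ x; 0, var A deg x]

theorem var_mul_C {i : ℤ} {a : A} (ha : a ∈ A.gr i) (x : X) :
    var A deg x * C A deg a = (i * deg x).negOnePow • (C A deg a * var A deg x) :=
  mon_mul_C A deg ha (FreeAddMonoid.of x)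

/-- The ring homomorphism to triangular matrices encoding a derivation. -/
def derivMatrix (δ : ∀ x, gr A deg (deg x + 1)) :
    FreePoly A deg →+* Matrix (Fin 2) (Fin 2) (FreePoly A deg) :=
  lift A deg (coeffMatrix A deg) (varMatrix δ) (by
    intro i a x ha
    -- The matrix relation is checked entrywise. In the corner, (-1)^|x| from σ(x) cancels the extra
    -- |x| in (i + 1)|x|, and the extra i in i(|x| + 1) is absorbed by σ(a).
    have h1 : gradedSign (gr A deg) (var A deg x) * C A deg (gradedSign A.gr a) =
        (i * deg x).negOnePow •
          (C A deg (gradedSign A.gr a) * gradedSign (gr A deg) (var A deg x)) := by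
      rw [← gradedSign_C, ← map_mul, var_mul_C ha, ← map_mul]
      exact map_negOnePow_smul (gradedSign (gr A deg)).toAddMonoidHom _ _
    have h2 : gradedSign (gr A deg) (var A deg x) * C A deg (A.d a) =
        (i * deg x).negOnePow • (C A deg (A.d a) * var A deg x) := by
      rw [gradedSign_of_mem _ (var_mem A deg x), smul_mul_assoc, var_mul_C (A.d_mem ha), smul_smul,
        ← Int.negOnePow_add, add_mul, one_mul, add_left_comm, Int.negOnePow_add, ← two_mul,
        Int.negOnePow_two_mul, mul_one]
    have h3 : (δ x : FreePoly A deg) * C A deg a =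
        (i * deg x).negOnePow • (C A deg (gradedSign A.gr a) * δ x) := by
      rw [mul_C deg hA ha (δ x).2, ← gradedSign_C, gradedSign_of_mem _ (C_mem A deg ha),
        smul_mul_assoc, smul_smul, ← Int.negOnePow_add, mul_add, mul_one]
    change varMatrix δ x * !![_, _; _, _] = _ • (!![_, _; _, _] * varMatrix δ x)
    rw [varMatrix, Matrix.mul_fin_two, Matrix.mul_fin_two, h1, h2, h3, var_mul_C ha]
    ext k l; fin_cases k <;> fin_cases l <;> simp [smul_add, add_comm])

/-- The derivation of `A⟨X⟩` extending the differential of `A`, with given values on variables. -/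
def deriv (δ : ∀ x, gr A deg (deg x + 1)) : FreePoly A deg →+ FreePoly A deg where
  toFun r := derivMatrix hA δ r 0 1
  map_zero' := by rw [map_zero]; rfl
  map_add' r s := by rw [map_add]; rfl

variable (δ : ∀ x, gr A deg (deg x + 1))

theorem derivMatrix_C (a : A) : derivMatrix hA δ (C A deg a) =
    !![C A deg (gradedSign A.gr a), C A deg (A.d a); 0, C A deg a] := lift_C A deg _ _ _ a

theorem derivMatrix_var (x : X) : derivMatrix hA δ (var A deg x) = varMatrix δ x :=
  lift_var A deg _ _ _ x

/-- The three other entries are multiplicative on upper triangular matrices, so generators determine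
them. With the diagonal known, the corner entry of a product is the graded Leibniz rule. -/
theorem derivMatrix_eq (r : FreePoly A deg) :
    derivMatrix hA δ r = !![gradedSign (gr A deg) r, deriv hA δ r; 0, r] := by
  suffices derivMatrix hA δ r 0 0 = gradedSign (gr A deg) r ∧ derivMatrix hA δ r 1 0 = 0 ∧
      derivMatrix hA δ r 1 1 = r by
    ext k l; fin_cases k <;> fin_cases l
    exacts [this.1, rfl, this.2.1, this.2.2]
  induction r using FreePoly.induction with
  | hC a => rw [derivMatrix_C, gradedSign_C]; exact ⟨rfl, rfl, rfl⟩
  | hvar x => rw [derivMatrix_var]; exact ⟨rfl, rfl, rfl⟩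
  | add r s hr hs =>
    simp only [map_add, Matrix.add_apply, hr, hs, add_zero, and_self]
  | mul r s hr hs =>
    simp only [map_mul, Matrix.mul_apply, Fin.sum_univ_two, hr, hs, mul_zero, zero_mul, add_zero,
      zero_add, and_self]

theorem deriv_C (a : A) : deriv hA δ (C A deg a) = C A deg (A.d a) := by
  change derivMatrix hA δ (C A deg a) 0 1 = _
  rw [derivMatrix_C]
  rfl

theorem deriv_var (x : X) : deriv hA δ (var A deg x) = δ x := by
  change derivMatrix hA δ (var A deg x) 0 1 = _
  rw [derivMatrix_var]
  rfl

theorem deriv_mul (r s : FreePoly A deg) :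
    deriv hA δ (r * s) = deriv hA δ r * s + gradedSign (gr A deg) r * deriv hA δ s := by
  change derivMatrix hA δ (r * s) 0 1 = _
  rw [map_mul, derivMatrix_eq, derivMatrix_eq, Matrix.mul_fin_two]
  exact add_comm _ _

theorem deriv_mul_mem {i j : ℤ} {r s : FreePoly A deg} (hr : r ∈ gr A deg i)
    (hs : s ∈ gr A deg j) (hr' : deriv hA δ r ∈ gr A deg (i + 1))
    (hs' : deriv hA δ s ∈ gr A deg (j + 1)) : deriv hA δ (r * s) ∈ gr A deg (i + j + 1) := by
  rw [deriv_mul, gradedSign_of_mem _ hr, smul_mul_assoc]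
  refine add_mem ?_ (Submodule.negOnePow_smul_mem _ _ ?_)
  · rw [add_right_comm]; exact mul_mem_gr A deg hr' hs
  · rw [add_assoc]; exact mul_mem_gr A deg hr hs'

theorem deriv_mon_mem (w : FreeAddMonoid X) :
    deriv hA δ (mon A deg w) ∈ gr A deg (monomialDegree deg w + 1) := by
  induction w using FreeAddMonoid.inductionOn with
  | zero =>
    rw [mon_zero, ← map_one (C A deg), deriv_C, A.d_one, map_zero (C A deg)]
    exact (gr A deg _).zero_mem
  | of x => rw [mon_of, deriv_var]; exact (δ x).2
  | add v w hv hw =>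
    rw [mon_add, map_add]
    exact deriv_mul_mem hA δ (mon_mem A deg v) (mon_mem A deg w) hv hw

theorem deriv_mem {i : ℤ} {r : FreePoly A deg} (hr : r ∈ gr A deg i) :
    deriv hA δ r ∈ gr A deg (i + 1) := by
  refine gr_induction (K := (gr A deg (i + 1)).toAddSubgroup.comap (deriv hA δ)) ?_ hr
  intro p a w ha hw
  change deriv hA δ _ ∈ gr A deg (i + 1)
  rw [← hw]
  refine deriv_mul_mem hA δ (C_mem A deg ha) (mon_mem A deg w) ?_ (deriv_mon_mem hA δ w)
  rw [deriv_C]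
  exact C_mem A deg (A.d_mem ha)

/-- The derivation raises degree by one, which flips the sign. This makes the cross terms σ(dr) · ds
and d(σr) · ds cancel in the square of the derivation. -/
theorem deriv_gradedSign (r : FreePoly A deg) :
    deriv hA δ (gradedSign (gr A deg) r) = -gradedSign (gr A deg) (deriv hA δ r) := by
  refine eq_of_eq_on_homogeneous (gr A deg)
    (f := (deriv hA δ).comp (gradedSign (gr A deg)).toAddMonoidHom)
    (g := -((gradedSign (gr A deg)).toAddMonoidHom.comp (deriv hA δ))) ?_ r
  intro i a ha
  change deriv hA δ (gradedSign (gr A deg) a) = -gradedSign (gr A deg) (deriv hA δ a)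
  rw [gradedSign_of_mem _ ha, gradedSign_of_mem _ (deriv_mem hA δ ha), map_negOnePow_smul,
    Int.negOnePow_succ, Units.neg_smul, neg_neg]

theorem deriv_deriv (h : ∀ x, deriv hA δ (δ x) = 0) (r : FreePoly A deg) :
    deriv hA δ (deriv hA δ r) = 0 := by
  induction r using FreePoly.induction with
  | hC a => rw [deriv_C, deriv_C, A.d_d, map_zero]
  | hvar x => rw [deriv_var, h]
  | add r s hr hs => rw [map_add, map_add, hr, hs, add_zero]
  | mul r s hr hs =>
    rw [deriv_mul, map_add, deriv_mul, deriv_mul, hr, hs, deriv_gradedSign, zero_mul, mul_zero,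
      zero_add, add_zero, neg_mul, add_neg_cancel]

/-- Derivations agreeing on a set of variables agree on the subring generated by it. -/
theorem deriv_congr {δ δ' : ∀ x, gr A deg (deg x + 1)} {s : Set X} (h : ∀ x ∈ s, δ x = δ' x)
    {r : FreePoly A deg} (hr : r ∈ Subring.closure (Set.range (C A deg) ∪ var A deg '' s)) :
    deriv hA δ r = deriv hA δ' r := by
  -- Agreement is tested on the matrix homomorphisms, whose equalizer is a subring, and is then read
  -- off in the corner entry.
  have : r ∈ RingHom.eqLocus (derivMatrix hA δ) (derivMatrix hA δ') := by
    refine Subring.closure_le.2 ?_ hr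
    rintro _ (⟨a, rfl⟩ | ⟨x, hx, rfl⟩)
    · exact (derivMatrix_C hA δ a).trans (derivMatrix_C hA δ' a).symm
    · refine (derivMatrix_var hA δ x).trans (Eq.trans ?_ (derivMatrix_var hA δ' x).symm)
      rw [varMatrix, varMatrix, h x hx]
  exact congrFun (congrFun this 0) 1

/-- The central DG `A`-ring with underlying graded ring `A⟨X⟩` and given differential. -/
def toDGRing (h : ∀ x, deriv hA δ (δ x) = 0) : DGRing where
  carrier := FreePoly A deg
  gr := gr A deg
  d := deriv hA δ
  d_mem := deriv_mem hA δ
  d_d := deriv_deriv hA δ h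
  leibniz {i j a b} ha _ := by rw [deriv_mul, gradedSign_of_mem _ ha, smul_mul_assoc]

/-- `A⟨X⟩` with a differential, as a central DG `A`-ring. -/
def toCentralDGRing (h : ∀ x, deriv hA δ (δ x) = 0) : CentralDGRing A where
  toDGRing := toDGRing hA δ h
  str :=
    { toRingHom := C A deg
      map_gr := C_mem A deg
      map_d := fun a => (deriv_C hA δ a).symm }
  central a := by
    change C A deg a ∈ (toDGRing hA δ h).center
    induction a using DirectSum.Decomposition.inductionOn A.gr with
    | zero => rw [map_zero]; exact zero_mem _
    | add a b ha hb => rw [map_add]; exact add_mem ha hb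
    | @homogeneous i a =>
      refine AddSubgroup.subset_closure ⟨i, C_mem A deg a.2, fun j b hb => ?_⟩
      exact mul_C deg hA a.2 hb

end FreePoly

/-! ### Homomorphisms from A⟨X⟩ to B and their compatibility with differentials. -/

namespace FreePoly

variable {A : DGRing.{u}} {X : Type w} {deg : X → ℤ} (B : CentralDGRing.{u, v} A)

/-- The ring homomorphism `A⟨X⟩ → B` with given values on the variables. -/
def evalHom (β : ∀ x, B.toDGRing.gr (deg x)) : FreePoly A deg →+* B.toDGRing :=
  lift A deg B.str.toRingHom (fun x => β x) (fun _ _ x ha => B.mul_str ha (β x).2)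

variable (β : ∀ x, B.toDGRing.gr (deg x))

theorem evalHom_C (a : A) : evalHom B β (C A deg a) = B.str.toRingHom a := lift_C A deg _ _ _ a

theorem evalHom_var (x : X) : evalHom B β (var A deg x) = β x := lift_var A deg _ _ _ x

theorem evalHom_mon_mem (w : FreeAddMonoid X) :
    evalHom B β (mon A deg w) ∈ B.toDGRing.gr (monomialDegree deg w) := by
  induction w using FreeAddMonoid.inductionOn with
  | zero => rw [mon_zero, map_one, map_zero]; exact SetLike.GradedOne.one_mem
  | of x => rw [mon_of, evalHom_var]; exact (β x).2
  | add v w hv hw => rw [mon_add, map_mul, map_add]; exact SetLike.GradedMul.mul_mem hv hw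

theorem evalHom_mem {i : ℤ} {r : FreePoly A deg} (hr : r ∈ gr A deg i) :
    evalHom B β r ∈ B.toDGRing.gr i := by
  refine gr_induction
    (K := (B.toDGRing.gr i).toAddSubgroup.comap (evalHom B β).toAddMonoidHom) ?_ hr
  intro p a w ha hw
  change evalHom B β (_ * _) ∈ B.toDGRing.gr i
  rw [map_mul, evalHom_C, ← hw]
  exact SetLike.GradedMul.mul_mem (B.str.map_gr ha) (evalHom_mon_mem B β w)

theorem evalHom_gradedSign (r : FreePoly A deg) :
    evalHom B β (gradedSign (gr A deg) r) = gradedSign B.toDGRing.gr (evalHom B β r) := by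
  refine eq_of_eq_on_homogeneous (gr A deg)
    (f := ((evalHom B β).comp (gradedSign (gr A deg))).toAddMonoidHom)
    (g := ((gradedSign B.toDGRing.gr).comp (evalHom B β)).toAddMonoidHom) ?_ r
  intro i r hr
  change evalHom B β (gradedSign (gr A deg) r) = gradedSign B.toDGRing.gr (evalHom B β r)
  rw [gradedSign_of_mem _ hr, gradedSign_of_mem _ (evalHom_mem B β hr)]
  exact map_negOnePow_smul (evalHom B β).toAddMonoidHom _ _

theorem evalHom_congr {β β' : ∀ x, B.toDGRing.gr (deg x)} {s : Set X} (h : ∀ x ∈ s, β x = β' x)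
    {r : FreePoly A deg} (hr : r ∈ Subring.closure (Set.range (C A deg) ∪ var A deg '' s)) :
    evalHom B β r = evalHom B β' r := by
  have : r ∈ RingHom.eqLocus (evalHom B β) (evalHom B β') := by
    refine Subring.closure_le.2 ?_ hr
    rintro _ (⟨a, rfl⟩ | ⟨x, hx, rfl⟩)
    · exact (evalHom_C B β a).trans (evalHom_C B β' a).symm
    · exact (evalHom_var B β x).trans ((congrArg _ (h x hx)).trans (evalHom_var B β' x).symm)
  exact this

variable (hA : A.IsCommutative) (δ : ∀ x, gr A deg (deg x + 1))

theorem evalHom_deriv (h : ∀ x, evalHom B β (δ x) = B.toDGRing.d (β x)) (r : FreePoly A deg) :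
    evalHom B β (deriv hA δ r) = B.toDGRing.d (evalHom B β r) := by
  induction r using FreePoly.induction with
  | hC a => rw [deriv_C, evalHom_C, evalHom_C, B.str.map_d]
  | hvar x => rw [deriv_var, evalHom_var, h]
  | add r s hr hs => rw [map_add, map_add, map_add, map_add, hr, hs]
  | mul r s hr hs =>
    rw [deriv_mul, map_add, map_mul, map_mul, map_mul, DGRing.d_mul, hr, hs, evalHom_gradedSign]

end FreePoly

/-! ### Self-labelling variables and their nesting depth. -/

/-- Formal noncommutative polynomial expressions with coefficients in `A`.  A variable of degree
`i` is labelled by an element of `B` (its image in `B`) and by an expression (its differential). -/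
inductive PolyExpr (A : Type u) (B : Type v) : Type (max u v)
  | coeff (a : A)
  | var (i : ℤ) (b : B) (e : PolyExpr A B)
  | add (e f : PolyExpr A B)
  | mul (e f : PolyExpr A B)

namespace PolyExpr

/-- The variables of the resolution: a degree, an image in `B`, and a differential. -/
abbrev Var (A : Type u) (B : Type v) : Type (max u v) := ℤ × B × PolyExpr A B

/-- The nesting depth of the variables. -/
def rank {A : Type u} {B : Type v} : PolyExpr A B → ℕ
  | coeff _ => 0
  | var _ _ e => rank e + 1
  | add e f => max (rank e) (rank f)
  | mul e f => max (rank e) (rank f)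

variable {A : DGRing.{u}} {B : Type v}

/-- The value of an expression in the noncommutative polynomial ring. -/
def eval : PolyExpr A B → FreePoly A (Prod.fst : Var A B → ℤ)
  | coeff a => FreePoly.C A _ a
  | var i b e => FreePoly.var A _ (i, b, e)
  | add e f => eval e + eval f
  | mul e f => eval e * eval f

/-- Every polynomial can thus occur as the prescribed differential of a variable. Several
expressions may have the same value; this only produces more variables. -/
theorem eval_surjective : Function.Surjective (eval (A := A) (B := B)) := fun r => by
  induction r using FreePoly.induction with
  | hC a => exact ⟨coeff a, rfl⟩
  | hvar x => exact ⟨var x.1 x.2.1 x.2.2, rfl⟩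
  | add r s hr hs =>
    obtain ⟨e, rfl⟩ := hr
    obtain ⟨f, rfl⟩ := hs
    exact ⟨add e f, rfl⟩
  | mul r s hr hs =>
    obtain ⟨e, rfl⟩ := hr
    obtain ⟨f, rfl⟩ := hs
    exact ⟨mul e f, rfl⟩

/-- The subring of polynomials in the variables of rank less than `n`. -/
def lower (A : DGRing.{u}) (B : Type v) (n : ℕ) :
    Subring (FreePoly A (Prod.fst : Var A B → ℤ)) :=
  Subring.closure (Set.range (FreePoly.C A _) ∪ FreePoly.var A _ '' {x | x.2.2.rank < n})

theorem lower_mono {m n : ℕ} (h : m ≤ n) : lower A B m ≤ lower A B n :=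
  Subring.closure_mono
    (Set.union_subset_union_right _ (Set.image_mono fun _ hx => lt_of_lt_of_le hx h))

/-- The shift matters: the expression `var i b e` has rank one more than e, while the variable (i,
b, e) is counted with the rank of e, hence lies strictly below. -/
theorem eval_mem_lower (e : PolyExpr A B) : eval e ∈ lower A B e.rank := by
  induction e with
  | coeff a => exact Subring.subset_closure (Or.inl ⟨a, rfl⟩)
  | var i b e _ => exact Subring.subset_closure (Or.inr ⟨(i, b, e), Nat.lt_succ_self _, rfl⟩)
  | add e f he hf =>
    exact add_mem (lower_mono (le_max_left _ _) he) (lower_mono (le_max_right _ _) hf)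
  | mul e f he hf =>
    exact mul_mem (lower_mono (le_max_left _ _) he) (lower_mono (le_max_right _ _) hf)

end PolyExpr

/-! ### Recursive definition of the differential and of the map to B on variables. -/

namespace Resolution

open FreePoly PolyExpr

variable {A : DGRing.{u}} (hA : A.IsCommutative) (B : CentralDGRing.{u, v} A)

/-- The degree of a variable. -/
abbrev deg : Var A B.toDGRing → ℤ := Prod.fst

/-- Values of a differential and of a homomorphism to `B` on the variables. -/
abbrev Data : Type (max u v) :=
  ∀ x : Var A B.toDGRing, gr A (deg B) (deg B x + 1) × B.toDGRing.gr (deg B x)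

variable {B}

/-- The differential and image prescribed by the label of a variable are consistent with the
differential and the homomorphism already defined. -/
def IsValid (f : Data B) (x : Var A B.toDGRing) : Prop :=
  x.2.1 ∈ B.toDGRing.gr (deg B x) ∧ x.2.2.eval ∈ gr A (deg B) (deg B x + 1) ∧
    deriv hA (fun y => (f y).1) x.2.2.eval = 0 ∧
    evalHom B (fun y => (f y).2) x.2.2.eval = B.toDGRing.d x.2.1

open Classical in
/-- The values on variables prescribed by their labels, when valid, and zero otherwise. -/
def step (f : Data B) : Data B := fun x =>
  if h : IsValid hA f x then (⟨x.2.2.eval, h.2.1⟩, ⟨x.2.1, h.1⟩) else 0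

/-- At x, the data enter only through the derivation and the evaluation of the expression labelling
x, which lies in the subring generated by A and the variables of smaller rank. This is what makes
the recursion consistent. -/
theorem step_congr {f g : Data B} {x : Var A B.toDGRing}
    (h : ∀ y : Var A B.toDGRing, y.2.2.rank < x.2.2.rank → f y = g y) :
    step hA f x = step hA g x := by
  have h1 : deriv hA (fun y => (f y).1) x.2.2.eval = deriv hA (fun y => (g y).1) x.2.2.eval :=
    deriv_congr hA (fun y hy => congrArg Prod.fst (h y hy)) x.2.2.eval_mem_lower
  have h2 : evalHom B (fun y => (f y).2) x.2.2.eval = evalHom B (fun y => (g y).2) x.2.2.eval :=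
    evalHom_congr B (fun y hy => congrArg Prod.snd (h y hy)) x.2.2.eval_mem_lower
  have h3 : IsValid hA f x ↔ IsValid hA g x := by rw [IsValid, IsValid, h1, h2]
  by_cases hf : IsValid hA f x
  · rw [step, step, dif_pos hf, dif_pos (h3.1 hf)]
  · rw [step, step, dif_neg hf, dif_neg (mt h3.2 hf)]

variable (B)

open Classical in
/-- The values on the variables of the differential and the homomorphism to `B`. -/
def data : Data B :=
  (measure fun x : Var A B.toDGRing => x.2.2.rank).wf.fix fun x rec =>
    step hA (fun y => if h : y.2.2.rank < x.2.2.rank then rec y h else 0) x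

/-- The recursion puts 0 at variables not of smaller rank; `step_congr` shows that these placeholder
values are never seen. Validity may therefore be tested against the final data. -/
theorem data_eq (x : Var A B.toDGRing) : data hA B x = step hA (data hA B) x := by
  rw [data, WellFounded.fix_eq]
  exact step_congr hA fun y hy => dif_pos hy

/-- The values of the differential on the variables. -/
def dVar (x : Var A B.toDGRing) : gr A (deg B) (deg B x + 1) := (data hA B x).1

/-- The values of the homomorphism on the variables. -/
def uVar (x : Var A B.toDGRing) : B.toDGRing.gr (deg B x) := (data hA B x).2

theorem of_isValid {x : Var A B.toDGRing} (h : IsValid hA (data hA B) x) :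
    (dVar hA B x : FreePoly A (deg B)) = x.2.2.eval ∧ (uVar hA B x : B.toDGRing) = x.2.1 := by
  rw [dVar, uVar, data_eq, step, dif_pos h]
  exact ⟨rfl, rfl⟩

theorem of_not_isValid {x : Var A B.toDGRing} (h : ¬ IsValid hA (data hA B) x) :
    (dVar hA B x : FreePoly A (deg B)) = 0 ∧ (uVar hA B x : B.toDGRing) = 0 := by
  rw [dVar, uVar, data_eq, step, dif_neg h]
  exact ⟨rfl, rfl⟩

/-- For a valid label this is one of the validity conditions; an invalid one has zero differential.
-/
theorem deriv_dVar (x : Var A B.toDGRing) : deriv hA (dVar hA B) (dVar hA B x) = 0 := by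
  by_cases h : IsValid hA (data hA B) x
  · rw [(of_isValid hA B h).1]; exact h.2.2.1
  · rw [(of_not_isValid hA B h).1, map_zero]

theorem evalHom_dVar (x : Var A B.toDGRing) :
    evalHom B (uVar hA B) (dVar hA B x) = B.toDGRing.d (uVar hA B x) := by
  by_cases h : IsValid hA (data hA B) x
  · rw [(of_isValid hA B h).1, (of_isValid hA B h).2]; exact h.2.2.2
  · rw [(of_not_isValid hA B h).1, (of_not_isValid hA B h).2, map_zero, map_zero]

/-- Consistent data are realized by a variable. -/
theorem exists_var {i : ℤ} {b : B.toDGRing} {r : FreePoly A (deg B)} (hb : b ∈ B.toDGRing.gr i)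
    (hr : r ∈ gr A (deg B) (i + 1)) (hd : deriv hA (dVar hA B) r = 0)
    (hu : evalHom B (uVar hA B) r = B.toDGRing.d b) :
    ∃ x, deriv hA (dVar hA B) x = r ∧ evalHom B (uVar hA B) x = b := by
  obtain ⟨e, rfl⟩ := eval_surjective r
  -- The hypotheses say exactly that the label (i, b, e) is valid, so this variable is the witness.
  have h := of_isValid hA B (x := (i, b, e)) ⟨hb, hr, hd, hu⟩
  exact ⟨_, (deriv_var hA _ _).trans h.1,
    (evalHom_var B _ _).trans h.2⟩

end Resolution

/-! ### From the lifting property to surjective quasi-isomorphisms. -/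

/-- A quasi-isomorphism criterion: cocycles lift to cocycles, and a cocycle mapping to a coboundary
is a coboundary. -/
theorem DGRing.Hom.isQuasiIso_of_lift {B : DGRing.{u}} {C : DGRing.{v}} (f : DGRing.Hom B C)
    (hsurj : ∀ c : C, C.d c = 0 → ∃ b : B, B.d b = 0 ∧ f.toRingHom b = c)
    (hinj : ∀ b : B, B.d b = 0 → (∃ c : C, C.d c = f.toRingHom b) → ∃ b' : B, B.d b' = b) :
    f.IsQuasiIso := by
  constructor
  · rw [injective_iff_map_eq_zero]
    intro y
    induction y using QuotientAddGroup.induction_on with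
    | H z =>
      intro hz
      obtain ⟨c, hc⟩ := (QuotientAddGroup.eq_zero_iff (f.mapCocycles z)).1 hz
      exact (QuotientAddGroup.eq_zero_iff z).2 (hinj z z.2 ⟨c, hc⟩)
  · intro y
    induction y using QuotientAddGroup.induction_on with
    | H z =>
      obtain ⟨b, hb, hbz⟩ := hsurj z z.2
      exact ⟨QuotientAddGroup.mk (⟨b, hb⟩ : B.cocycles), congrArg _ (Subtype.ext hbz)⟩

/-- The differential is compatible with the decomposition into homogeneous components. -/
theorem DGRing.coe_decompose_d (B : DGRing.{u}) (b : B) (i : ℤ) :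
    (DirectSum.decompose B.gr (B.d b) (i + 1) : B) = B.d (DirectSum.decompose B.gr b i) := by
  induction b using DirectSum.Decomposition.inductionOn B.gr with
  | zero => simp
  | add b b' hb hb' =>
    rw [map_add, DirectSum.decompose_add, DirectSum.decompose_add, DirectSum.add_apply,
      DirectSum.add_apply, Submodule.coe_add, Submodule.coe_add, map_add, hb, hb']
  | @homogeneous j b =>
    by_cases h : j = i
    · subst h
      rw [DirectSum.decompose_of_mem_same _ (B.d_mem b.2), DirectSum.decompose_of_mem_same _ b.2]
    · rw [DirectSum.decompose_of_mem_ne _ (B.d_mem b.2) (by omega),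
        DirectSum.decompose_of_mem_ne _ b.2 h, map_zero]

theorem DGRing.Hom.coe_decompose {B : DGRing.{u}} {C : DGRing.{v}} (f : DGRing.Hom B C) (b : B)
    (i : ℤ) : (DirectSum.decompose C.gr (f.toRingHom b) i : C) =
      f.toRingHom (DirectSum.decompose B.gr b i) := by
  induction b using DirectSum.Decomposition.inductionOn B.gr with
  | zero => simp
  | add b b' hb hb' =>
    rw [map_add, DirectSum.decompose_add, DirectSum.decompose_add, DirectSum.add_apply,
      DirectSum.add_apply, Submodule.coe_add, Submodule.coe_add, map_add, hb, hb']
  | @homogeneous j b =>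
    by_cases h : j = i
    · subst h
      rw [DirectSum.decompose_of_mem_same _ (f.map_gr b.2), DirectSum.decompose_of_mem_same _ b.2]
    · rw [DirectSum.decompose_of_mem_ne _ (f.map_gr b.2) h,
        DirectSum.decompose_of_mem_ne _ b.2 h, map_zero]

/-- A homomorphism such that every compatible pair of a homogeneous cocycle and a cochain bounding
its image can be lifted is a surjective quasi-isomorphism. -/
theorem DGRing.Hom.surjective_and_isQuasiIso {B : DGRing.{u}} {C : DGRing.{v}} (f : DGRing.Hom B C)
    (h : ∀ (i : ℤ) (c : C) (b : B), c ∈ C.gr i → b ∈ B.gr (i + 1) → B.d b = 0 →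
      f.toRingHom b = C.d c → ∃ x : B, B.d x = b ∧ f.toRingHom x = c) :
    Function.Surjective f.toRingHom ∧ f.IsQuasiIso := by
  classical
  have hcocycle : ∀ (i : ℤ) (c : C), c ∈ C.gr i → C.d c = 0 →
      ∃ x : B, B.d x = 0 ∧ f.toRingHom x = c := fun i c hc hd =>
    h i c 0 hc (zero_mem _) (map_zero _) (by rw [map_zero, hd])
  refine ⟨fun c => ?_, f.isQuasiIso_of_lift (fun c hc => ?_) fun b hb hbc => ?_⟩
  · induction c using DirectSum.Decomposition.inductionOn C.gr with
    | zero => exact ⟨0, map_zero _⟩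
    | add c c' hc hc' =>
      obtain ⟨x, rfl⟩ := hc
      obtain ⟨x', rfl⟩ := hc'
      exact ⟨x + x', map_add _ _ _⟩
    | @homogeneous i c =>
      -- A non-closed c needs a cocycle over d c first. The lift need not be homogeneous, so its
      -- component of degree i + 1 is used; that component is still closed and still maps to d c.
      obtain ⟨b, hb, hbc⟩ := hcocycle (i + 1) (C.d c) (C.d_mem c.2) (C.d_d _)
      obtain ⟨x, -, hx⟩ := h i c (DirectSum.decompose B.gr b (i + 1)) c.2 (SetLike.coe_mem _)
        (by rw [← B.coe_decompose_d, hb, DirectSum.decompose_zero]; rfl)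
        (by rw [← f.coe_decompose, hbc, DirectSum.decompose_of_mem_same _ (C.d_mem c.2)])
      exact ⟨x, hx⟩
  -- Cohomology here is total, so cocycles may be inhomogeneous: each component is lifted separately
  -- and the finitely many lifts are summed.
  · have : ∀ i, ∃ x : B, B.d x = 0 ∧ f.toRingHom x = DirectSum.decompose C.gr c i := fun i =>
      hcocycle i _ (SetLike.coe_mem _)
        (by rw [← C.coe_decompose_d, hc, DirectSum.decompose_zero]; rfl)
    choose x hx hxc using this
    refine ⟨∑ i ∈ (DirectSum.decompose C.gr c).support, x i, ?_, ?_⟩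
    · rw [map_sum]
      exact Finset.sum_eq_zero fun i _ => hx i
    · rw [map_sum, Finset.sum_congr rfl fun i _ => hxc i]
      exact DirectSum.sum_support_decompose C.gr c
  · obtain ⟨c, hc⟩ := hbc
    have : ∀ i, ∃ x : B, B.d x = DirectSum.decompose B.gr b i := fun i => by
      -- The component of b in degree k + 1 is paired with the component of c in degree k.
      obtain ⟨k, rfl⟩ : ∃ k, i = k + 1 := ⟨i - 1, (sub_add_cancel i 1).symm⟩
      obtain ⟨x, hx, -⟩ := h k (DirectSum.decompose C.gr c k) (DirectSum.decompose B.gr b (k + 1))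
        (SetLike.coe_mem _) (SetLike.coe_mem _)
        (by rw [← B.coe_decompose_d, hb, DirectSum.decompose_zero]; rfl)
        (by rw [← f.coe_decompose, ← hc, C.coe_decompose_d])
      exact ⟨x, hx⟩
    choose x hx using this
    refine ⟨∑ i ∈ (DirectSum.decompose B.gr b).support, x i, ?_⟩
    rw [map_sum, Finset.sum_congr rfl fun i _ => hx i]
    exact DirectSum.sum_support_decompose B.gr b

/-! ### The resolution and its semi-basis. -/

namespace Resolution

open FreePoly PolyExpr

variable {A : DGRing.{u}} (hA : A.IsCommutative) (B : CentralDGRing.{u, v} A)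

/-- The semi-free resolution of `B`. -/
def resolution : CentralDGRing.{u, max u v} A :=
  toCentralDGRing hA (dVar hA B) (deriv_dVar hA B)

/-- The homomorphism from the resolution to `B`. -/
def resolutionHom : (resolution hA B).Hom B where
  toRingHom := evalHom B (uVar hA B)
  map_gr := evalHom_mem B (uVar hA B)
  map_d := evalHom_deriv B (uVar hA B) hA (dVar hA B) (evalHom_dVar hA B)
  map_str := evalHom_C B (uVar hA B)

/-- The variables, filtered by rank. -/
def filteredVar : FilteredGradedSet.{max u v} where
  X := Var A B.toDGRing
  deg := Prod.fst
  -- The strict inequality leaves F_0 empty: variables of rank 0, whose differentials lie in A,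
  -- first appear in F_1.
  F j := {x | (x.2.2.rank : ℤ) < j}
  F_neg j hj := Set.eq_empty_of_forall_notMem fun x (hx : (x.2.2.rank : ℤ) < j) => by omega
  mono _ _ hij _ hx := lt_of_lt_of_le hx hij
  exhaustive := Set.eq_univ_of_forall fun x =>
    Set.mem_iUnion.2 ⟨x.2.2.rank + 1, lt_add_one (x.2.2.rank : ℤ)⟩

theorem dVar_mem_lower (x : Var A B.toDGRing) :
    (dVar hA B x : FreePoly A (deg B)) ∈ lower A B.toDGRing x.2.2.rank := by
  by_cases h : IsValid hA (data hA B) x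
  · rw [(of_isValid hA B h).1]
    exact eval_mem_lower _
  · rw [(of_not_isValid hA B h).1]
    exact zero_mem _

/-- The identity, as an isomorphism from the resolution to the noncommutative polynomial ring. -/
def polyEquiv : (resolution hA B).toDGRing ≃+* NCPoly A (filteredVar B).deg :=
  RingEquiv.refl (NCPoly A (filteredVar B).deg)

theorem isSemiBasis : (resolution hA B).IsSemiBasis (filteredVar B) (polyEquiv hA B) where
  map_str _ := rfl
  map_gr _ _ := Iff.rfl
  d_var j _ x hx := by
    have hx : (x.2.2.rank : ℤ) < j := hx
    have h := dVar_mem_lower hA B x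
    rw [← deriv_var hA (dVar hA B) x] at h
    -- Since 0 ≤ rank x < j, the index j - 1 is nonnegative, which selects the subring branch;
    -- variables of rank below that of x then lie in F_{j-1}.
    rw [NCPoly.filtration, if_pos (by omega)]
    refine Subring.closure_mono (Set.union_subset_union_right _ (Set.image_mono ?_)) h
    intro y hy
    have hy : y.2.2.rank < x.2.2.rank := hy
    change (y.2.2.rank : ℤ) < j - 1
    omega

end Resolution

end

theorem mainTheorem5 (A : DGRing.{u}) (hA : A.IsCommutative) (hA0 : Nontrivial A)
    (B : CentralDGRing.{u, v} A) :
    ∃ (B' : CentralDGRing.{u, max u v} A) (f : B'.Hom B), f.IsSemiFreeResolution := by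
  have h := (Resolution.resolutionHom hA B).toHom.surjective_and_isQuasiIso
    fun _ _ _ hc hb hdb hbc => Resolution.exists_var hA B hc hb hdb hbc
  exact ⟨_, Resolution.resolutionHom hA B,
    ⟨⟨_, _, Resolution.isSemiBasis hA B⟩, h.1, h.2⟩⟩
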